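/- \textbf{Generalised Quantum Pl\"ucker Relations for Quantum Grassmannians.} Let $k$ be a field, $0\neq q\in k$, and let $1\le m\le n$ be integers. Let $\mathcal O_q(M_{mn})$ be the $k$-algebra generated by $X_{ij}$ ($1\le i\le m$, $1\le j\le n$) subject to the relations $$X_{ij}X_{il}=qX_{il}X_{ij},\qquad X_{ij}X_{rj}=qX_{rj}X_{ij},\qquad X_{il}X_{rj}=X_{rj}X_{il},\qquad X_{ij}X_{rl}-X_{rl}X_{ij}=(q-q^{-1})X_{il}X_{rj}$$ for $1\le i<r\le m$ and $1\le j<l\le n$ (the first also for every row $i$, and the second also for every column $j$). For $J=\{j_1<\dots<j_m\}\subseteq\{1,\dots,n\}$ let $$[J]=\sum_{\sigma\in S_m}(-q)^{l(\sigma)}X_{1,j_{\sigma(1)}}\cdots X_{m,j_{\sigma(m)}}$$ be the maximal quantum minor with column set $J$, where $l(\sigma)$ is the number of inversions of $\sigma$, and let $\mathcal G_q(m,n)$ be the subalgebra of $\mathcal O_q(M_{mn})$ generated by all these $[J]$. For $I,J\subseteq\{1,\dots,n\}$ put $\ell(I;J)=|\{(i,j)\in I\times J: i>j\}|$. Let $J_1,J_2,K\subseteq\{1,\dots,n\}$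 be such that $|J_1|,|J_2|\le m$ and $|K|=2m-|J_1|-|J_2|>m$. Then in $\mathcal G_q(m,n)$ $$\sum_{K'\sqcup K''=K}(-q)^{\ell(J_1;K')+\ell(K';K'')+\ell(K'';J_2)}\,[J_1\sqcup K']\,[K''\sqcup J_2]=0,$$ where the sum runs over all pairs $(K',K'')$ of disjoint sets with union $K$ such that $J_1\cap K'=\emptyset=K''\cap J_2$ and $|J_1\sqcup K'|=|K''\sqcup J_2|=m$. -/

import Mathlib

namespace QuantumGrassmannian

/-- The defining relations of the algebra of quantum `m × n` matrices, imposed on the free algebra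
on indeterminates `X (i, j)`. -/
inductive Rel {k : Type*} [Field k] (q : k) (m n : ℕ) :
    FreeAlgebra k (Fin m × Fin n) → FreeAlgebra k (Fin m × Fin n) → Prop
  | row (i : Fin m) (j l : Fin n) (hjl : j < l) :
      Rel q m n (FreeAlgebra.ι k (i, j) * FreeAlgebra.ι k (i, l))
        (q • (FreeAlgebra.ι k (i, l) * FreeAlgebra.ι k (i, j)))
  | col (i r : Fin m) (j : Fin n) (hir : i < r) :
      Rel q m n (FreeAlgebra.ι k (i, j) * FreeAlgebra.ι k (r, j))
        (q • (FreeAlgebra.ι k (r, j) * FreeAlgebra.ι k (i, j)))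
  | anti (i r : Fin m) (j l : Fin n) (hir : i < r) (hjl : j < l) :
      Rel q m n (FreeAlgebra.ι k (i, l) * FreeAlgebra.ι k (r, j))
        (FreeAlgebra.ι k (r, j) * FreeAlgebra.ι k (i, l))
  | diag (i r : Fin m) (j l : Fin n) (hir : i < r) (hjl : j < l) :
      Rel q m n
        (FreeAlgebra.ι k (i, j) * FreeAlgebra.ι k (r, l) -
          FreeAlgebra.ι k (r, l) * FreeAlgebra.ι k (i, j))
        ((q - q⁻¹) • (FreeAlgebra.ι k (i, l) * FreeAlgebra.ι k (r, j)))

/-- The coordinate ring `O_q(M_{mn})` of quantum `m × n` matrices. -/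
abbrev QuantumMatrices {k : Type*} [Field k] (q : k) (m n : ℕ) : Type _ :=
  RingQuot (Rel q m n)

/-- The canonical generator `X_{ij}` of `O_q(M_{mn})`. -/
noncomputable def X {k : Type*} [Field k] (q : k) {m n : ℕ} (i : Fin m) (j : Fin n) :
    QuantumMatrices q m n :=
  RingQuot.mkAlgHom k (Rel q m n) (FreeAlgebra.ι k (i, j))

/-- The length of a permutation: its number of inversions. -/
def permLength {s : ℕ} (σ : Equiv.Perm (Fin s)) : ℕ :=
  ((Finset.univ : Finset (Fin s × Fin s)).filter (fun p => p.1 < p.2 ∧ σ p.2 < σ p.1)).card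

/-- The quantum minor `[I | J]`: the quantum determinant
`∑_σ (-q)^{l(σ)} X_{i_1, j_{σ(1)}} ⋯ X_{i_s, j_{σ(s)}}`, where `i_1 < ⋯ < i_s` and
`j_1 < ⋯ < j_s` are the elements of `I` and `J`. -/
noncomputable def quantumMinor {k : Type*} [Field k] (q : k) {m n s : ℕ}
    (I : Finset (Fin m)) (J : Finset (Fin n)) (hI : I.card = s) (hJ : J.card = s) :
    QuantumMatrices q m n :=
  ∑ σ : Equiv.Perm (Fin s), (-q) ^ permLength σ •
    (List.ofFn fun t : Fin s => X q (I.orderEmbOfFin hI t) (J.orderEmbOfFin hJ (σ t))).prod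

/-- The maximal quantum minor on all `m` rows and the column set `J`, in `O_q(M_{mn})`. -/
noncomputable def maximalMinor {k : Type*} [Field k] (q : k) {m n : ℕ}
    (J : Finset (Fin n)) (hJ : J.card = m) : QuantumMatrices q m n :=
  quantumMinor q Finset.univ J (Finset.card_fin m) hJ

/-- The quantum grassmannian `G_q(m,n)`: the subalgebra of `O_q(M_{mn})` generated by the
`m × m` quantum minors. -/
noncomputable def Gq {k : Type*} [Field k] (q : k) (m n : ℕ) :
    Subalgebra k (QuantumMatrices q m n) :=
  Algebra.adjoin k {x | ∃ (J : Finset (Fin n)) (hJ : J.card = m), x = maximalMinor q J hJ}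

/-- The generator `[J]` of `G_q(m,n)`. -/
noncomputable def bracket {k : Type*} [Field k] (q : k) {m n : ℕ}
    (J : Finset (Fin n)) (hJ : J.card = m) : Gq q m n :=
  ⟨maximalMinor q J hJ, Algebra.subset_adjoin ⟨J, hJ, rfl⟩⟩

/-- `ℓ(I; J) = |{(i, j) ∈ I × J : i > j}|`. -/
def ell {n : ℕ} (I J : Finset (Fin n)) : ℕ :=
  ((I ×ˢ J).filter (fun p => p.2 < p.1)).card

/-- The index set of the sum: pairs `(K', K'')` with `K' ⊔ K'' = K` for which `J₁ ⊔ K'` and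
`K'' ⊔ J₂` are disjoint unions with `m` elements, so that `[J₁ ⊔ K']` and `[K'' ⊔ J₂]` make
sense. -/
abbrev Splitting {n : ℕ} (m : ℕ) (J₁ J₂ K : Finset (Fin n)) : Type :=
  {p : Finset (Fin n) × Finset (Fin n) //
    (Disjoint p.1 p.2 ∧ p.1 ∪ p.2 = K) ∧
    (Disjoint J₁ p.1 ∧ J₁.card + p.1.card = m) ∧
    (Disjoint p.2 J₂ ∧ p.2.card + J₂.card = m)}

end QuantumGrassmannian

/-! Laplace-expand each `[J₁ ⊔ K']` along the columns `J₁`, `K'`, with `R` the rows used by `J₁`,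
and each `[K'' ⊔ J₂]` along `K''`, `J₂`, with `S` the rows used by `K''`. For fixed `R` and `S` the
sum over `K'` is an expansion of a minor with columns `K` and row word `Rᶜ` followed by `S`. That
word has length `|K| > m`, so a row repeats and the sum vanishes (`pluecker`). For this, minors are
indexed by arbitrary row words. Splitting a word is then formal (`wordMinor_append`), the quantum
relations enter only when rows are reordered (`wordMinor_sort_append_sort`), and
`wordMinor_transpose` turns row expansions into column expansions. -/

namespace QuantumGrassmannian

/-! ### Additivity of the exponent `ell`. -/

section Ell

variable {n : ℕ}

@[simp] theorem ell_empty_left (J : Finset (Fin n)) : ell ∅ J = 0 := by simp [ell]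

@[simp] theorem ell_empty_right (I : Finset (Fin n)) : ell I ∅ = 0 := by simp [ell]

theorem ell_union_left {I I' : Finset (Fin n)} (h : Disjoint I I') (J : Finset (Fin n)) :
    ell (I ∪ I') J = ell I J + ell I' J := by
  rw [ell, ell, ell, Finset.union_product, Finset.filter_union, Finset.card_union_of_disjoint]
  exact Finset.disjoint_filter_filter (Finset.disjoint_product.2 (Or.inl h))

theorem ell_union_right (I : Finset (Fin n)) {J J' : Finset (Fin n)} (h : Disjoint J J') :
    ell I (J ∪ J') = ell I J + ell I J' := by
  rw [ell, ell, ell, Finset.product_union, Finset.filter_union, Finset.card_union_of_disjoint]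
  exact Finset.disjoint_filter_filter (Finset.disjoint_product.2 (Or.inr h))

theorem ell_insert_left {x : Fin n} {I : Finset (Fin n)} (h : x ∉ I) (J : Finset (Fin n)) :
    ell (insert x I) J = ell {x} J + ell I J := by
  rw [Finset.insert_eq, ell_union_left (by simpa using h)]

theorem ell_insert_right (I : Finset (Fin n)) {x : Fin n} {J : Finset (Fin n)} (h : x ∉ J) :
    ell I (insert x J) = ell I {x} + ell I J := by
  rw [Finset.insert_eq, ell_union_right _ (by simpa using h)]

theorem ell_eq_zero {I J : Finset (Fin n)} (h : ∀ x ∈ I, ∀ y ∈ J, x ≤ y) : ell I J = 0 := by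
  rw [ell, Finset.card_eq_zero, Finset.filter_eq_empty_iff]
  rintro ⟨x, y⟩ hxy
  rw [Finset.mem_product] at hxy
  exact not_lt.2 (h x hxy.1 y hxy.2)

theorem ell_singleton_singleton {x y : Fin n} (h : y < x) : ell {x} {y} = 1 := by
  rw [ell, Finset.singleton_product_singleton, Finset.filter_singleton, if_pos h,
    Finset.card_singleton]

theorem ell_singleton_left (x : Fin n) (J : Finset (Fin n)) :
    ell {x} J = (J.filter (· < x)).card := by
  rw [ell]
  exact (Finset.card_bij (fun y _ => (x, y)) (by simp) (by simp) (by aesop)).symm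

end Ell

/-! ### Minors along row words, with no relations on the entries. -/

section WordMinor

variable {k A : Type*} [Field k] [Ring A] [Algebra k A] {m n : ℕ}

/-- The minor of the matrix `Y` on the columns `J`, with the rows taken in the order of a given
list, defined by iterated expansion along the first row. -/
def wordMinor (q : k) (Y : Fin m → Fin n → A) : List (Fin m) → Finset (Fin n) → A
  | [], J => if J = ∅ then 1 else 0
  | a :: l, J =>
      ∑ j ∈ J, (-q) ^ ell {j} (J.erase j) • (Y a j * wordMinor q Y l (J.erase j))

variable (q : k) (Y : Fin m → Fin n → A)

theorem wordMinor_nil (J : Finset (Fin n)) :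
    wordMinor q Y [] J = if J = ∅ then 1 else 0 := rfl

theorem wordMinor_cons (a : Fin m) (l : List (Fin m)) (J : Finset (Fin n)) :
    wordMinor q Y (a :: l) J =
      ∑ j ∈ J, (-q) ^ ell {j} (J.erase j) • (Y a j * wordMinor q Y l (J.erase j)) := rfl

/-- This default value lets the expansions run over full powersets without size constraints. -/
theorem wordMinor_eq_zero_of_card_ne (l : List (Fin m)) (J : Finset (Fin n))
    (h : l.length ≠ J.card) : wordMinor q Y l J = 0 := by
  induction l generalizing J with
  | nil =>
    rw [wordMinor_nil, if_neg]
    rintro rfl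
    simp at h
  | cons a l ih =>
    rw [wordMinor_cons]
    refine Finset.sum_eq_zero fun j hj => ?_
    rw [ih, mul_zero, smul_zero]
    have := Finset.card_erase_add_one hj
    rw [List.length_cons] at h
    omega

theorem wordMinor_sort_eq_zero_of_card_ne (S : Finset (Fin m)) (J : Finset (Fin n))
    (h : S.card ≠ J.card) : wordMinor q Y S.sort J = 0 :=
  wordMinor_eq_zero_of_card_ne q Y _ J (by rwa [Finset.length_sort])

theorem sum_powerset_sum_mem {M : Type*} [AddCommMonoid M] (K : Finset (Fin n))
    (f : Finset (Fin n) → Fin n → M) :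
    ∑ S ∈ K.powerset, ∑ j ∈ S, f S j =
      ∑ j ∈ K, ∑ T ∈ (K.erase j).powerset, f (insert j T) j := by
  rw [Finset.sum_sigma', Finset.sum_sigma']
  refine Finset.sum_bij' (fun p _ => ⟨p.2, p.1.erase p.2⟩) (fun p _ => ⟨insert p.1 p.2, p.1⟩)
    ?_ ?_ ?_ ?_ ?_
  · rintro ⟨S, j⟩ h
    simp only [Finset.mem_sigma, Finset.mem_powerset] at h ⊢
    exact ⟨h.1 h.2, Finset.erase_subset_erase _ h.1⟩
  · rintro ⟨j, T⟩ h
    simp only [Finset.mem_sigma, Finset.mem_powerset] at h ⊢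
    exact ⟨Finset.insert_subset h.1 (h.2.trans (Finset.erase_subset _ _)),
      Finset.mem_insert_self _ _⟩
  · rintro ⟨S, j⟩ h
    simp only [Finset.mem_sigma] at h
    simp [Finset.insert_erase h.2]
  · rintro ⟨j, T⟩ h
    simp only [Finset.mem_sigma, Finset.mem_powerset] at h
    have : j ∉ T := fun hj => Finset.notMem_erase j K (h.2 hj)
    simp [Finset.erase_insert this]
  · rintro ⟨S, j⟩ h
    simp only [Finset.mem_sigma] at h
    simp [Finset.insert_erase h.2]

/-- Only additivity of `ell` is needed: the factors stay in row order, so no entries are commuted.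
-/
theorem wordMinor_append (a b : List (Fin m)) (K : Finset (Fin n)) :
    wordMinor q Y (a ++ b) K =
      ∑ S ∈ K.powerset, (-q) ^ ell S (K \ S) •
        (wordMinor q Y a S * wordMinor q Y b (K \ S)) := by
  induction a generalizing K with
  | nil =>
    rw [Finset.sum_eq_single_of_mem ∅ (Finset.empty_mem_powerset K)]
    · simp [wordMinor_nil]
    · intro S _ hS
      simp [wordMinor_nil, hS]
  | cons x a ih =>
    simp only [wordMinor_cons, List.cons_append, Finset.sum_mul, Finset.smul_sum]
    rw [sum_powerset_sum_mem]
    refine Finset.sum_congr rfl fun j hj => ?_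
    rw [ih, Finset.mul_sum, Finset.smul_sum]
    refine Finset.sum_congr rfl fun T hT => ?_
    rw [Finset.mem_powerset] at hT
    have hjT : j ∉ T := fun h => Finset.notMem_erase j K (hT h)
    have hsd : K \ insert j T = K.erase j \ T := by ext; simp; tauto
    have hun : T ∪ (K.erase j \ T) = K.erase j := Finset.union_sdiff_of_subset hT
    have hl : ell {j} (K.erase j) = ell {j} T + ell {j} (K.erase j \ T) := by
      rw [← ell_union_right _ Finset.disjoint_sdiff, hun]
    rw [Finset.erase_insert hjT, hsd, ell_insert_left hjT, hl]
    simp only [smul_mul_assoc, mul_smul_comm, smul_smul, ← pow_add, mul_assoc]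
    congr 2
    ring

theorem sum_sum_erase {M : Type*} [AddCommMonoid M] (J : Finset (Fin n)) (f : Fin n → Fin n → M) :
    ∑ j ∈ J, ∑ l ∈ J.erase j, f j l =
      ∑ j ∈ J, ∑ l ∈ J.filter (j < ·), (f j l + f l j) := by
  have h1 : ∀ j ∈ J, ∑ l ∈ J.erase j, f j l =
      ∑ l ∈ J.filter (j < ·), f j l + ∑ l ∈ J.filter (· < j), f j l := by
    intro j _
    rw [← Finset.sum_union]
    · refine Finset.sum_congr ?_ fun _ _ => rfl
      ext l
      simp only [Finset.mem_erase, Finset.mem_union, Finset.mem_filter]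
      grind
    · rw [Finset.disjoint_filter]
      exact fun l _ h => not_lt.2 h.le
  rw [Finset.sum_congr rfl h1]
  simp only [Finset.sum_add_distrib]
  congr 1
  refine Finset.sum_comm' fun x y => ?_
  simp only [Finset.mem_filter]
  tauto

/-- Pairing the choices `(j, l)` and `(l, j)` makes the first two rows enter only through 2 × 2
quantum minors, so row exchange becomes a 2 × 2 computation. -/
theorem wordMinor_cons_cons (a b : Fin m) (w : List (Fin m)) (J : Finset (Fin n)) :
    wordMinor q Y (a :: b :: w) J =
      ∑ j ∈ J, ∑ l ∈ J.filter (j < ·),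
        (-q) ^ (ell {j} ((J.erase j).erase l) + ell {l} ((J.erase j).erase l)) •
          ((Y a j * Y b l + (-q) • (Y a l * Y b j)) *
            wordMinor q Y w ((J.erase j).erase l)) := by
  simp only [wordMinor_cons, Finset.mul_sum, Finset.smul_sum]
  rw [sum_sum_erase]
  refine Finset.sum_congr rfl fun j hj => Finset.sum_congr rfl fun l hl => ?_
  rw [Finset.mem_filter] at hl
  obtain ⟨hl, hjl⟩ := hl
  rw [Finset.erase_right_comm (a := l) (b := j)]
  set R := (J.erase j).erase l with hR
  have hj' : j ∉ R := by simp [hR]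
  have hl' : l ∉ R := by simp [hR]
  have e1 : J.erase j = insert l R := by
    rw [hR, Finset.insert_erase (Finset.mem_erase.2 ⟨hjl.ne', hl⟩)]
  have e2 : J.erase l = insert j R := by
    rw [hR, Finset.erase_right_comm, Finset.insert_erase (Finset.mem_erase.2 ⟨hjl.ne, hj⟩)]
  rw [e1, e2, ell_insert_right _ hj', ell_insert_right _ hl', ell_singleton_singleton hjl,
    ell_eq_zero (I := {j}) (J := {l}) (by simpa using hjl.le)]
  simp only [mul_smul_comm, smul_mul_assoc, smul_smul, add_mul, smul_add, ← mul_assoc]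
  congr 2 <;> ring

end WordMinor

/-! ### Row exchange, transposition and Laplace expansions for quantum matrices. -/

section QuantumMatrix

variable {k A : Type*} [Field k] [Ring A] [Algebra k A] {m n : ℕ}

/-- The entries of `Y` satisfy the defining relations of quantum matrices. -/
structure IsQuantumMatrix (q : k) (Y : Fin m → Fin n → A) : Prop where
  row : ∀ (i : Fin m) (j l : Fin n), j < l → Y i j * Y i l = q • (Y i l * Y i j)
  col : ∀ (i r : Fin m) (j : Fin n), i < r → Y i j * Y r j = q • (Y r j * Y i j)
  anti : ∀ (i r : Fin m) (j l : Fin n), i < r → j < l → Y i l * Y r j = Y r j * Y i l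
  diag : ∀ (i r : Fin m) (j l : Fin n), i < r → j < l →
    Y i j * Y r l - Y r l * Y i j = (q - q⁻¹) • (Y i l * Y r j)

variable {q : k} {Y : Fin m → Fin n → A}

theorem IsQuantumMatrix.transpose (h : IsQuantumMatrix q Y) :
    IsQuantumMatrix q (fun j i => Y i j) where
  row i j l hjl := h.col j l i hjl
  col i r j hir := h.row j i r hir
  anti i r j l hir hjl := (h.anti j l i r hjl hir).symm
  diag i r j l hir hjl := by rw [h.diag j l i r hjl hir, h.anti j l i r hjl hir]

theorem IsQuantumMatrix.wordMinor_cons_cons_self (h : IsQuantumMatrix q Y) (a : Fin m)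
    (w : List (Fin m)) (J : Finset (Fin n)) : wordMinor q Y (a :: a :: w) J = 0 := by
  rw [wordMinor_cons_cons]
  refine Finset.sum_eq_zero fun j _ => Finset.sum_eq_zero fun l hl => ?_
  rw [h.row a j l (Finset.mem_filter.1 hl).2, neg_smul, add_neg_cancel, zero_mul, smul_zero]

theorem IsQuantumMatrix.wordMinor_swap (h : IsQuantumMatrix q Y) (hq : q ≠ 0) {i r : Fin m}
    (hir : i < r) (w : List (Fin m)) (J : Finset (Fin n)) :
    wordMinor q Y (r :: i :: w) J = (-q) • wordMinor q Y (i :: r :: w) J := by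
  rw [wordMinor_cons_cons, wordMinor_cons_cons, Finset.smul_sum]
  refine Finset.sum_congr rfl fun j _ => ?_
  rw [Finset.smul_sum]
  refine Finset.sum_congr rfl fun l hl => ?_
  have hjl := (Finset.mem_filter.1 hl).2
  have hY : Y r j * Y i l + (-q) • (Y r l * Y i j) =
      (-q) • (Y i j * Y r l + (-q) • (Y i l * Y r j)) := by
    have hc : -q * (q - q⁻¹) = 1 - q * q := by field_simp; ring
    rw [← h.anti i r j l hir hjl, sub_eq_iff_eq_add.1 (h.diag i r j l hir hjl)]
    simp only [smul_add, smul_smul]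
    rw [hc]
    module
  rw [hY, smul_mul_assoc, smul_comm]

/-- Move `x` rightwards into its sorted place: each smaller row passed costs `-q`, and meeting an
equal row gives zero. -/
theorem IsQuantumMatrix.wordMinor_cons_sort (h : IsQuantumMatrix q Y) (hq : q ≠ 0) (x : Fin m)
    (S : Finset (Fin m)) (J : Finset (Fin n)) :
    wordMinor q Y (x :: S.sort) J =
      if x ∈ S then 0 else (-q) ^ ell {x} S • wordMinor q Y (insert x S).sort J := by
  induction S using Finset.induction_on_min generalizing J with
  | empty => simp
  | insert y S hy ih =>
    have hyS : y ∉ S := fun hm => lt_irrefl _ (hy y hm)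
    have hsort : (insert y S).sort = y :: S.sort :=
      Finset.sort_insert _ (fun b hb => (hy b hb).le) hyS
    rw [hsort]
    rcases lt_trichotomy x y with hxy | rfl | hxy
    · have hlt : ∀ b ∈ insert y S, x < b := by
        intro b hb
        rcases Finset.mem_insert.1 hb with rfl | hb
        · exact hxy
        · exact hxy.trans (hy b hb)
      have hx : x ∉ insert y S := fun hm => lt_irrefl _ (hlt x hm)
      rw [if_neg hx, ell_eq_zero (by simpa using ⟨hxy.le, fun b hb => (hxy.trans (hy b hb)).le⟩),
        Finset.sort_insert _ (fun b hb => (hlt b hb).le) hx, hsort, pow_zero, one_smul]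
    · rw [h.wordMinor_cons_cons_self, if_pos (Finset.mem_insert_self _ _)]
    · rw [h.wordMinor_swap hq hxy, wordMinor_cons]
      simp only [ih, Finset.mem_insert, hxy.ne', false_or]
      split_ifs with hx
      · simp
      · have hmin : ∀ b ∈ insert x S, y < b := by
          intro b hb
          rcases Finset.mem_insert.1 hb with rfl | hb
          · exact hxy
          · exact hy b hb
        rw [Finset.insert_comm, Finset.sort_insert _ (fun b hb => (hmin b hb).le)
          (fun hm => lt_irrefl _ (hmin y hm)), wordMinor_cons, ell_insert_right _ hyS,
          ell_singleton_singleton hxy, add_comm, pow_succ', mul_smul]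
        congr 1
        rw [Finset.smul_sum]
        refine Finset.sum_congr rfl fun j _ => ?_
        simp only [mul_smul_comm]
        rw [smul_comm ((-q) ^ ell {j} _)]

theorem IsQuantumMatrix.wordMinor_sort_append_sort (h : IsQuantumMatrix q Y) (hq : q ≠ 0)
    (S T : Finset (Fin m)) (J : Finset (Fin n)) :
    wordMinor q Y (S.sort ++ T.sort) J =
      if Disjoint S T then (-q) ^ ell S T • wordMinor q Y (S ∪ T).sort J else 0 := by
  induction S using Finset.induction_on_min generalizing J with
  | empty => simp
  | insert x S hx ih =>
    have hxS : x ∉ S := fun hm => lt_irrefl _ (hx x hm)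
    rw [Finset.sort_insert _ (fun b hb => (hx b hb).le) hxS, List.cons_append, wordMinor_cons]
    simp only [ih, Finset.disjoint_insert_left]
    by_cases hd : Disjoint S T
    · have key := h.wordMinor_cons_sort hq x (S ∪ T) J
      rw [wordMinor_cons] at key
      simp only [if_pos hd, mul_smul_comm]
      simp only [smul_comm _ ((-q) ^ ell S T)]
      rw [← Finset.smul_sum, key, Finset.insert_union]
      by_cases hxT : x ∈ T
      · simp [hxT]
      -- Since `x` lies below all of `S`, it passes only elements of `T`.
      · rw [if_neg (by simp [hxS, hxT]), if_pos ⟨hxT, hd⟩, smul_smul, ← pow_add, ell_insert_left hxS,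
          ell_union_right _ hd, ell_eq_zero (J := S) (by simpa using fun b hb => (hx b hb).le),
          zero_add, add_comm]
    · simp [hd]

/-- The transpose of a quantum matrix has the same minors. -/
theorem IsQuantumMatrix.wordMinor_transpose (h : IsQuantumMatrix q Y)
    (S : Finset (Fin m)) (J : Finset (Fin n)) :
    wordMinor q Y S.sort J = wordMinor q (fun j i => Y i j) J.sort S := by
  induction hc : S.card using Nat.strong_induction_on generalizing S J with
  | _ c ih =>
  subst hc
  rcases S.eq_empty_or_nonempty with rfl | hS
  · rcases J.eq_empty_or_nonempty with rfl | hJ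
    · simp [wordMinor_nil]
    · rw [wordMinor_sort_eq_zero_of_card_ne _ _ J ∅ (by simpa using hJ.ne_empty)]
      simp [wordMinor_nil, hJ.ne_empty]
  rcases J.eq_empty_or_nonempty with rfl | hJ
  · rw [wordMinor_sort_eq_zero_of_card_ne _ _ S ∅ (by simpa using hS.ne_empty)]
    simp [wordMinor_nil, hS.ne_empty]
  obtain ⟨i₁, S', hi₁, rfl⟩ : ∃ i₁ S', (∀ x ∈ S', i₁ < x) ∧ S = insert i₁ S' :=
    ⟨S.min' hS, S.erase (S.min' hS), fun x hx => Finset.min'_lt_of_mem_erase_min' _ _ hx,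
      (Finset.insert_erase (S.min'_mem hS)).symm⟩
  obtain ⟨j₁, J', hj₁, rfl⟩ : ∃ j₁ J', (∀ x ∈ J', j₁ < x) ∧ J = insert j₁ J' :=
    ⟨J.min' hJ, J.erase (J.min' hJ), fun x hx => Finset.min'_lt_of_mem_erase_min' _ _ hx,
      (Finset.insert_erase (J.min'_mem hJ)).symm⟩
  have hiS : i₁ ∉ S' := fun hm => lt_irrefl _ (hi₁ _ hm)
  have hjJ : j₁ ∉ J' := fun hm => lt_irrefl _ (hj₁ _ hm)
  have hcard : (insert i₁ S').card = S'.card + 1 := Finset.card_insert_of_notMem hiS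
  have hsS : ∀ T ⊆ S', (insert i₁ T).sort = i₁ :: T.sort := fun T hT =>
    Finset.sort_insert _ (fun b hb => (hi₁ b (hT hb)).le) fun hm => hiS (hT hm)
  have hsJ : ∀ T ⊆ J', (insert j₁ T).sort = j₁ :: T.sort := fun T hT =>
    Finset.sort_insert _ (fun b hb => (hj₁ b (hT hb)).le) fun hm => hjJ (hT hm)
  rw [hsS S' subset_rfl, hsJ J' subset_rfl, wordMinor_cons, wordMinor_cons,
    Finset.sum_insert hiS, Finset.sum_insert hjJ, Finset.erase_insert hiS,
    Finset.erase_insert hjJ, ih _ (by omega) S' J' rfl,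
    ell_eq_zero (I := {i₁}) (by simpa using fun b hb => (hi₁ b hb).le),
    ell_eq_zero (I := {j₁}) (by simpa using fun b hb => (hj₁ b hb).le)]
  -- The corner terms agree by induction. Each remaining term is expanded once more, along column
  -- `j₁` on the left and row `i₁` on the right; the two double sums then differ only in the order
  -- of `Y i₁ j` and `Y i j₁`, which commute by `anti`.
  congr 1
  have hL : ∀ j ∈ J', (-q) ^ ell {j} ((insert j₁ J').erase j) •
      (Y i₁ j * wordMinor q Y S'.sort ((insert j₁ J').erase j)) =
      ∑ i ∈ S', (-q) ^ (1 + ell {j} (J'.erase j) + ell {i} (S'.erase i)) •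
        (Y i₁ j * Y i j₁ * wordMinor q (fun j i => Y i j) (J'.erase j).sort (S'.erase i)) := by
    intro j hj
    have hne := hj₁ j hj
    have hni : j₁ ∉ J'.erase j := fun hm => hjJ (Finset.mem_of_mem_erase hm)
    rw [ih _ (by omega) S' _ rfl, Finset.erase_insert_of_ne hne.ne,
      hsJ _ (Finset.erase_subset _ _), wordMinor_cons, ell_insert_right _ hni,
      ell_singleton_singleton hne, Finset.mul_sum, Finset.smul_sum]
    refine Finset.sum_congr rfl fun i _ => ?_
    rw [mul_smul_comm, smul_smul, ← pow_add, mul_assoc]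
  have hR : ∀ i ∈ S', (-q) ^ ell {i} ((insert i₁ S').erase i) •
      (Y i j₁ * wordMinor q (fun j i => Y i j) J'.sort ((insert i₁ S').erase i)) =
      ∑ j ∈ J', (-q) ^ (1 + ell {j} (J'.erase j) + ell {i} (S'.erase i)) •
        (Y i₁ j * Y i j₁ * wordMinor q (fun j i => Y i j) (J'.erase j).sort (S'.erase i)) := by
    intro i hi
    have hne := hi₁ i hi
    have hni : i₁ ∉ S'.erase i := fun hm => hiS (Finset.mem_of_mem_erase hm)
    have hce := Finset.card_erase_add_one hi
    have hci := Finset.card_insert_of_notMem hni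
    rw [Finset.erase_insert_of_ne hne.ne, ← ih _ (by omega) _ J' rfl,
      hsS _ (Finset.erase_subset _ _), wordMinor_cons, ell_insert_right _ hni,
      ell_singleton_singleton hne, Finset.mul_sum, Finset.smul_sum]
    refine Finset.sum_congr rfl fun j hj => ?_
    rw [ih _ (by omega) _ _ rfl, mul_smul_comm, smul_smul, ← pow_add, ← mul_assoc,
      h.anti i₁ i j₁ j hne (hj₁ j hj)]
    congr 2
    ring
  rw [Finset.sum_congr rfl hL, Finset.sum_congr rfl hR, Finset.sum_comm]

/-- Expansion of a minor along a set of rows. -/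
theorem IsQuantumMatrix.sum_wordMinor_col (h : IsQuantumMatrix q Y) (hq : q ≠ 0)
    (S T : Finset (Fin m)) (J : Finset (Fin n)) :
    ∑ J' ∈ J.powerset, (-q) ^ ell J' (J \ J') •
        (wordMinor q Y S.sort J' * wordMinor q Y T.sort (J \ J')) =
      if Disjoint S T then (-q) ^ ell S T • wordMinor q Y (S ∪ T).sort J else 0 := by
  rw [← wordMinor_append, h.wordMinor_sort_append_sort hq]

/-- Expansion of a minor along a set of columns. -/
theorem IsQuantumMatrix.sum_wordMinor_row (h : IsQuantumMatrix q Y) (hq : q ≠ 0)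
    (S : Finset (Fin m)) (J K : Finset (Fin n)) :
    ∑ S' ∈ S.powerset, (-q) ^ ell S' (S \ S') •
        (wordMinor q Y S'.sort J * wordMinor q Y (S \ S').sort K) =
      if Disjoint J K then (-q) ^ ell J K • wordMinor q Y S.sort (J ∪ K) else 0 := by
  simp only [h.wordMinor_transpose]
  exact h.transpose.sum_wordMinor_col hq J K S

/-- The generalised Plücker relations, as a sum over all subsets of `K`. -/
theorem IsQuantumMatrix.pluecker (h : IsQuantumMatrix q Y) (hq : q ≠ 0)
    (J₁ J₂ K : Finset (Fin n)) (hK : K.card + J₁.card + J₂.card = 2 * m) (hKm : m < K.card) :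
    ∑ K' ∈ K.powerset, (-q) ^ ell K' (K \ K') •
      ((if Disjoint J₁ K' then
          (-q) ^ ell J₁ K' • wordMinor q Y Finset.univ.sort (J₁ ∪ K') else 0) *
        (if Disjoint (K \ K') J₂ then
          (-q) ^ ell (K \ K') J₂ • wordMinor q Y Finset.univ.sort (K \ K' ∪ J₂) else 0)) = 0 := by
  -- The conditional factors are exactly the values of column expansions, including the zero case.
  simp only [← h.sum_wordMinor_row hq, Finset.sum_mul_sum, Finset.smul_sum]
  rw [Finset.sum_comm]
  refine Finset.sum_eq_zero fun R _ => ?_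
  rw [Finset.sum_comm]
  refine Finset.sum_eq_zero fun S _ => ?_
  by_cases hR : R.card = J₁.card
  swap
  · rw [wordMinor_sort_eq_zero_of_card_ne q Y R J₁ hR]
    simp
  by_cases hS : (Finset.univ \ S).card = J₂.card
  swap
  · rw [wordMinor_sort_eq_zero_of_card_ne q Y (Finset.univ \ S) J₂ hS]
    simp
  -- Here `|Rᶜ| + |S| = (m - |J₁|) + (m - |J₂|) = |K| > m`.
  have hnd : ¬ Disjoint (Finset.univ \ R) S := by
    intro hd
    have h1 := Finset.card_union_of_disjoint hd
    have h2 := Finset.card_le_univ (Finset.univ \ R ∪ S)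
    have h3 := Finset.card_sdiff_add_card_eq_card (Finset.subset_univ R)
    have h4 := Finset.card_sdiff_add_card_eq_card (Finset.subset_univ S)
    simp only [Finset.card_univ, Fintype.card_fin] at h2 h3 h4
    omega
  have key := h.sum_wordMinor_col hq (Finset.univ \ R) S K
  rw [if_neg hnd] at key
  calc _ = ((-q) ^ ell R (Finset.univ \ R) * (-q) ^ ell S (Finset.univ \ S)) •
        (wordMinor q Y R.sort J₁ *
        (∑ K' ∈ K.powerset, (-q) ^ ell K' (K \ K') •
        (wordMinor q Y (Finset.univ \ R).sort K' * wordMinor q Y S.sort (K \ K'))) *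
        wordMinor q Y (Finset.univ \ S).sort J₂) := by
        rw [Finset.mul_sum, Finset.sum_mul, Finset.smul_sum]
        refine Finset.sum_congr rfl fun K' _ => ?_
        simp only [smul_mul_assoc, mul_smul_comm, smul_smul, mul_assoc]
        congr 1
        ring
    _ = 0 := by rw [key]; simp

end QuantumMatrix

/-! ### Comparison of the recursive minors with the permutation sum. -/

section MaximalMinor

/-- The number of inversions of a word. -/
def inversions {s n : ℕ} (w : Fin s → Fin n) : ℕ :=
  ∑ a, ∑ b, if a < b ∧ w b < w a then 1 else 0

theorem inversions_cons {s n : ℕ} (j : Fin n) {w : Fin s → Fin n} (hw : w.Injective) :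
    inversions (Fin.cons j w : Fin (s + 1) → Fin n) =
      ell {j} (Finset.univ.image w) + inversions w := by
  rw [inversions, Fin.sum_univ_succ]
  congr 1
  · rw [ell_singleton_left, Finset.filter_image, Finset.card_image_of_injective _ hw,
      Finset.card_filter, Fin.sum_univ_succ]
    simp
  · refine Finset.sum_congr rfl fun a _ => ?_
    rw [Fin.sum_univ_succ]
    simp only [Fin.cons_succ, Fin.succ_lt_succ_iff, Fin.not_lt_zero, false_and, if_false, zero_add]

theorem permLength_eq_inversions {s n : ℕ} (e : Fin s ↪o Fin n) (σ : Equiv.Perm (Fin s)) :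
    permLength σ = inversions (fun t => e (σ t)) := by
  rw [permLength, inversions, Finset.card_filter, ← Finset.univ_product_univ, Finset.sum_product]
  simp

variable {k A : Type*} [Field k] [Ring A] [Algebra k A] {m n : ℕ}

/-- Unfolding the recursion picks one column per row; the exponents collected along the way count
inversions by `inversions_cons`. -/
theorem wordMinor_ofFn (q : k) (Y : Fin m → Fin n → A) {s : ℕ} (a : Fin s → Fin m)
    (J : Finset (Fin n)) :
    wordMinor q Y (List.ofFn a) J =
      ∑ w : Fin s → Fin n with w.Injective ∧ Finset.univ.image w = J,
        (-q) ^ inversions w • (List.ofFn fun t => Y (a t) (w t)).prod := by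
  induction s generalizing J with
  | zero =>
    rw [List.ofFn_zero, wordMinor_nil, Finset.sum_filter]
    simp [inversions, Function.injective_of_subsingleton, eq_comm]
  | succ s ih =>
    rw [List.ofFn_succ, wordMinor_cons]
    simp only [ih, Finset.mul_sum, Finset.smul_sum]
    rw [Finset.sum_sigma']
    refine Finset.sum_bij' (fun p _ => Fin.cons p.1 p.2) (fun w _ => ⟨w 0, Fin.tail w⟩)
      ?_ ?_ ?_ ?_ ?_
    · rintro ⟨j, w⟩ h
      simp only [Finset.mem_sigma, Finset.mem_filter, Finset.mem_univ, true_and] at h ⊢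
      obtain ⟨hj, hw, him⟩ := h
      constructor
      · rw [Fin.cons_injective_iff]
        refine ⟨?_, hw⟩
        rintro ⟨t, ht⟩
        have : w t ∈ J.erase j := him ▸ Finset.mem_image_of_mem w (Finset.mem_univ t)
        exact (Finset.mem_erase.1 this).1 ht
      · rw [← Finset.insert_erase hj, ← him]
        ext x
        simp [Fin.exists_fin_succ, eq_comm]
    · intro w h
      simp only [Finset.mem_sigma, Finset.mem_filter, Finset.mem_univ, true_and] at h ⊢
      obtain ⟨hw, rfl⟩ := h
      refine ⟨Finset.mem_image_of_mem w (Finset.mem_univ 0),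
        hw.comp (Fin.succ_injective s), ?_⟩
      ext x
      simp only [Finset.mem_image, Finset.mem_univ, true_and, Finset.mem_erase,
        Fin.exists_fin_succ, Fin.tail]
      constructor
      · rintro ⟨t, rfl⟩
        exact ⟨hw.ne (Fin.succ_ne_zero t), Or.inr ⟨t, rfl⟩⟩
      · rintro ⟨hx, hx' | hx'⟩
        · exact absurd hx'.symm hx
        · exact hx'
    · rintro ⟨j, w⟩ _
      simp
    · intro w _
      simp
    · rintro ⟨j, w⟩ h
      simp only [Finset.mem_sigma, Finset.mem_filter, Finset.mem_univ, true_and] at h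
      obtain ⟨hj, hw, him⟩ := h
      rw [inversions_cons j hw, him, List.ofFn_succ, List.prod_cons, mul_smul_comm, smul_smul,
        pow_add]
      simp

theorem isQuantumMatrix_X (q : k) (m n : ℕ) :
    IsQuantumMatrix q (X q : Fin m → Fin n → QuantumMatrices q m n) where
  row i j l h := by simpa [X] using RingQuot.mkAlgHom_rel k (Rel.row (q := q) i j l h)
  col i r j h := by simpa [X] using RingQuot.mkAlgHom_rel k (Rel.col (q := q) i r j h)
  anti i r j l h h' := by simpa [X] using RingQuot.mkAlgHom_rel k (Rel.anti (q := q) i r j l h h')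
  diag i r j l h h' := by simpa [X] using RingQuot.mkAlgHom_rel k (Rel.diag (q := q) i r j l h h')

theorem maximalMinor_eq_wordMinor (q : k) (J : Finset (Fin n)) (hJ : J.card = m) :
    maximalMinor q J hJ = wordMinor q (X q) Finset.univ.sort J := by
  have hu : ∀ t : Fin m, (Finset.univ : Finset (Fin m)).orderEmbOfFin (Finset.card_fin m) t = t :=
    fun t => congrFun (Finset.orderEmbOfFin_unique (Finset.card_fin m) (f := id)
      (fun _ => Finset.mem_univ _) strictMono_id).symm t
  rw [Fin.sort_univ, ← List.ofFn_id, wordMinor_ofFn, maximalMinor, quantumMinor]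
  simp only [hu, id]
  -- Permutations correspond to injective words with image `J` through the increasing enumeration of
  -- `J`.
  refine Finset.sum_bij (fun σ _ t => J.orderEmbOfFin hJ (σ t)) ?_ ?_ ?_ ?_
  · intro σ _
    simp only [Finset.mem_filter, Finset.mem_univ, true_and]
    refine ⟨(J.orderEmbOfFin hJ).injective.comp σ.injective, ?_⟩
    apply Finset.coe_injective
    rw [Finset.coe_image, Finset.coe_univ, Set.image_univ, ← Finset.range_orderEmbOfFin J hJ]
    exact σ.surjective.range_comp _
  · intro σ _ τ _ h
    ext t
    rw [(J.orderEmbOfFin hJ).injective (congrFun h t)]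
  · intro w hw
    simp only [Finset.mem_filter, Finset.mem_univ, true_and] at hw
    obtain ⟨hw, him⟩ := hw
    have hex : ∀ t, ∃ u, J.orderEmbOfFin hJ u = w t := by
      intro t
      have : w t ∈ (J : Set (Fin n)) :=
        Finset.mem_coe.2 (him ▸ Finset.mem_image_of_mem w (Finset.mem_univ t))
      rwa [← Finset.range_orderEmbOfFin J hJ] at this
    choose u hu' using hex
    have hinj : u.Injective := fun x y hxy => hw (by rw [← hu', ← hu', hxy])
    exact ⟨Equiv.ofBijective u (Finite.injective_iff_bijective.1 hinj), Finset.mem_univ _,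
      funext hu'⟩
  · intro σ _
    rw [permLength_eq_inversions (J.orderEmbOfFin hJ)]

end MaximalMinor

end QuantumGrassmannian

/-! ### The relations in the quantum grassmannian. -/

open QuantumGrassmannian in
theorem mainTheorem9 {k : Type*} [Field k] (q : k) (hq : q ≠ 0) (m n : ℕ) (hm : 0 < m)
    (hmn : m ≤ n) (J₁ J₂ K : Finset (Fin n)) (hJ₁ : J₁.card ≤ m) (hJ₂ : J₂.card ≤ m)
    (hK : (K.card : ℤ) = 2 * (m : ℤ) - J₁.card - J₂.card) (hKm : m < K.card) :
    ∑ p : QuantumGrassmannian.Splitting m J₁ J₂ K,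
      (-q) ^ (QuantumGrassmannian.ell J₁ p.1.1 + QuantumGrassmannian.ell p.1.1 p.1.2 +
          QuantumGrassmannian.ell p.1.2 J₂) •
        (QuantumGrassmannian.bracket q (J₁.disjUnion p.1.1 p.2.2.1.1)
            ((Finset.card_disjUnion _ _ _).trans p.2.2.1.2) *
          QuantumGrassmannian.bracket q (p.1.2.disjUnion J₂ p.2.2.2.1)
            ((Finset.card_disjUnion _ _ _).trans p.2.2.2.2)) =
      (0 : QuantumGrassmannian.Gq q m n) := by
  apply Subtype.ext
  rw [AddSubmonoidClass.coe_finsetSum, ZeroMemClass.coe_zero,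
    ← (isQuantumMatrix_X q m n).pluecker hq J₁ J₂ K (by omega) hKm]
  have hsdiff : ∀ p : Splitting m J₁ J₂ K, K \ p.1.1 = p.1.2 := by
    rintro ⟨⟨S, T⟩, ⟨hd, rfl⟩, -⟩
    exact Finset.union_sdiff_cancel_left hd
  -- A splitting is determined by `K'`. The other subsets of `K` contribute zero, by a failed
  -- disjointness or by a minor of the wrong size; once `|J₁ ∪ K'| = m`, the size of `K` forces
  -- `|K'' ∪ J₂| = m`.
  refine Finset.sum_of_injOn (fun p => p.1.1) ?_ ?_ ?_ ?_
  · intro p _ p' _ h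
    refine Subtype.ext (Prod.ext h ?_)
    rw [← hsdiff p, ← hsdiff p']
    exact congrArg (K \ ·) h
  · rintro ⟨⟨S, T⟩, ⟨hd, rfl⟩, -⟩ _
    exact Finset.mem_coe.2 (Finset.mem_powerset.2 Finset.subset_union_left)
  · intro S hS hne
    rw [Finset.mem_powerset] at hS
    split_ifs with h₁ h₂
    · rw [wordMinor_sort_eq_zero_of_card_ne q _ Finset.univ (J₁ ∪ S)]
      · simp
      · intro hc
        rw [Finset.card_fin, Finset.card_union_of_disjoint h₁] at hc
        have := Finset.card_sdiff_add_card_eq_card hS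
        exact hne ⟨⟨(S, K \ S), ⟨Finset.disjoint_sdiff, Finset.union_sdiff_of_subset hS⟩,
          ⟨h₁, hc.symm⟩, h₂, by dsimp only; omega⟩, by simp, rfl⟩
    all_goals simp
  · intro p _
    rw [hsdiff p, if_pos p.2.2.1.1, if_pos p.2.2.2.1, smul_mul_smul_comm, smul_smul,
      ← pow_add, ← pow_add, ← Finset.disjUnion_eq_union _ _ p.2.2.1.1,
      ← Finset.disjUnion_eq_union _ _ p.2.2.2.1,
      ← maximalMinor_eq_wordMinor q _ ((Finset.card_disjUnion _ _ _).trans p.2.2.1.2),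
      ← maximalMinor_eq_wordMinor q _ ((Finset.card_disjUnion _ _ _).trans p.2.2.2.2),
      add_left_comm, ← add_assoc]
    rfl
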